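/- **Model (discrete time, shared clock).** Time is $\mathbb T=\{0,1,2,\dots\}$. A context $\gamma$ consists of a directed graph $\mathcal G_\gamma$ on a (possibly infinite) set of agents, each edge $(i,j)$ having a weight $b_\gamma(i,j)\in\{1,2,\dots\}\cup\{\infty\}$; an infinite set $S_i$ of legal states for each agent $i$; an infinite set of messages; and a set of external inputs, each input $\tilde e$ being observed by a single agent $i_{\tilde e}$. A protocol assigns to each agent $i$ a nonempty set of possible initial states and a function that maps the state of $i$ just before time $t$, the external inputs observed by $i$ at $t$, the messages (with their senders) delivered to $i$ at $t$, and $t$ itself, to a new state of $i$, a set of messages to be sent to out-neighbours of $i$ at $t$, and the decision whether $i$ responds at $t$. A run of a protocol consists of an initial state for each agent and, for each $t\in\mathbb T$, the agents' states and the external inputs and deliveries at $t$, such that all agents follow the protocol, each external input occurs at most once, each message sent by $i$ to $j$ at time $t$ is delivered exactly once, at some $t'\in\mathbb T$ with $t<t'\le t+b_\gamma(i,j)$, and only messages that were sent are delivered. **Problems.** Fix an external input $\tilde e$. A run is *triggered* if $\tilde e$ occurs in it. For a set $I$ of agents, $\mathrm{ER}(\tilde e,I)$ is the set of protocols such that in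 every triggered run each $i\in I$ responds exactly once, and in every other run no $i\in I$ responds; $\mathsf t_r(i)$ denotes the response time of $i$ in the run $r$, and is $\infty$ if $i$ does not respond. *Simultaneous response* $\mathrm{SR}(\tilde e,I)$ is the set of $P\in\mathrm{ER}(\tilde e,I)$ such that $\mathsf t_r$ is constant on $I$ for every run $r$ of $P$. For $\delta$ assigning to each ordered pair of distinct elements of $I$ a value in $\mathbb Z\cup\{\infty\}$, *timely-coordinated response* $\mathrm{TCR}(\tilde e,I,\delta)$ is the set of $P\in\mathrm{ER}(\tilde e,I)$ such that $\mathsf t_r(j)\le\mathsf t_r(i)+\delta(i,j)$ for all distinct $i,j\in I$ and all triggered runs $r$ of $P$. A problem is *solvable* if it is nonempty. **Graphs.** $G_\delta$ is the weighted directed graph on $I$ whose edges are the pairs $(i,j)$ of distinct elements with $\delta(i,j)<\infty$, with weight $\delta(i,j)$. A path in a directed graph is a nonempty finite sequence of vertices, consecutive ones being joined by edges. $\hat\delta_{\mathcal G_\gamma}(i,j)\in[0,\infty]$ is the infimum of the lengths of the paths from $i$ to $j$ in $\mathcal G_\gamma$ ($\infty$ if there is none). **Statement.** Let $\gamma$ be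 such a context, $\tilde e$ an external input, and $I$ a finite set of agents. Below, $\delta$ takes values in $\mathbb Z\cup\{\infty\}$. 1. If $\mathcal G_\gamma$ is strongly connected and $G_\delta$ contains no negative cycles, then the following are equivalent: (a) $\mathrm{TCR}(\tilde e,I,\delta)$ is solvable; (b) $\mathrm{SR}(\tilde e,J)$ is solvable for each strongly connected component $J$ of $G_\delta$; (c) for every strongly connected component $J$ of $G_\delta$ there is an agent $i$ of $\gamma$ (not necessarily in $I$) such that $\hat\delta_{\mathcal G_\gamma}(i,j)<\infty$ for every $j\in J$. 2. For an arbitrary $\mathcal G_\gamma$: if $G_\delta$ is strongly connected and contains no negative cycles, then $\mathrm{TCR}(\tilde e,I,\delta)$ is solvable if and only if $\mathrm{SR}(\tilde e,I)$ is solvable. Moreover, the following are equivalent: $\mathrm{TCR}(\tilde e,I,\delta)$ is solvable for some $\delta$ such that $G_\delta$ is strongly connected and contains no negative cycles; $\mathrm{TCR}(\tilde e,I,\delta)$ is solvable for every such $\delta$; $\mathrm{SR}(\tilde e,I)$ is solvable. 3. For an arbitrary $\mathcal G_\gamma$: if $G_\delta$ contains no negative cycles, then $\mathrm{TCR}(\tilde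 e,I,\delta)$ is solvable if and only if for every $n\ge1$ and every tuple $(I_1,\dots,I_n)$ of strongly connected components of $G_\delta$ such that for each $1\le m<n$ there is a path in $G_\delta$ from $I_m$ to $I_{m+1}$, there are agents $i_1,\dots,i_n$ of $\gamma$ such that $\mathcal G_\gamma$ has a path from $i_{\tilde e}$ through $i_n$, through $i_{n-1}$, …, to $i_1$, and $\hat\delta_{\mathcal G_\gamma}(i_m,j)<\infty$ for every $1\le m\le n$ and every $j\in I_m$. -/

import Mathlib

universe u v w x

/-- A weighted directed graph on the vertex type `V` with weights in `W`
(only the weights of edges are meaningful). -/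
structure WDigraph (V : Type*) (W : Type*) where
  Adj : V → V → Prop
  weight : V → V → W

namespace WDigraph

variable {V : Type*} {W : Type*}

/-- `p` is a path from `i` to `j`: a nonempty tuple of vertices whose consecutive entries are
joined by edges, with first entry `i` and last entry `j`. Vertices may repeat, and `[i]` is a
path from `i` to `i`. -/
def IsPath (G : WDigraph V W) (i j : V) (p : List V) : Prop :=
  p.IsChain G.Adj ∧ p.head? = some i ∧ p.getLast? = some j

/-- The length of a path: the sum of the weights of its edges. -/
def pathLength [AddMonoid W] (G : WDigraph V W) (p : List V) : W :=
  (List.zipWith G.weight p p.tail).sum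

/-- There is a path from `i` to `j`. -/
def Reach (G : WDigraph V W) (i j : V) : Prop := ∃ p, G.IsPath i j p

def StronglyConnected (G : WDigraph V W) : Prop := ∀ i j, G.Reach i j

/-- `J` is a strongly connected component of `G`. -/
def IsSCC (G : WDigraph V W) (J : Set V) : Prop :=
  ∃ i, J = {j | G.Reach i j ∧ G.Reach j i}

/-- No closed path has negative length. -/
def NoNegCycle [AddMonoid W] [LT W] (G : WDigraph V W) : Prop :=
  ∀ i p, G.IsPath i i p → ¬ G.pathLength p < 0

/-- The distance function: the infimum of the lengths of all paths from `i` to `j`. -/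
noncomputable def dist [AddMonoid W] [CompleteLattice W] (G : WDigraph V W) (i j : V) : W :=
  sInf {L | ∃ p, G.IsPath i j p ∧ G.pathLength p = L}

end WDigraph

/-- A context: the network graph on the agents, whose edge weights are the maximal delivery
times (positive integers or `∞`), the legal states of every agent, the possible messages, and
the possible external inputs, each observed by a single agent. -/
structure Context where
  Agent : Type u
  State : Agent → Type v
  Msg : Type w
  Input : Type x
  observer : Input → Agent
  graph : WDigraph Agent ℕ∞
  weight_pos : ∀ i j, graph.Adj i j → 0 < graph.weight i j

namespace Context

/-- What agent `i` does at one time: the new state, the messages sent (each to a neighbour),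
and whether `i` responds. -/
structure Action (γ : Context.{u, v, w, x}) (i : γ.Agent) where
  newState : γ.State i
  sends : Set (γ.Msg × {j : γ.Agent // γ.graph.Adj i j})
  responds : Prop

/-- A shared-clock local protocol of `i`: a nonempty set of possible initial states, and a
function that maps the state just before time `t`, the external inputs observed by `i` at `t`,
the messages (with their senders) delivered to `i` at `t`, and `t` itself, to an action. -/
structure LocalProtocol (γ : Context.{u, v, w, x}) (i : γ.Agent) where
  initial : Set (γ.State i)
  initial_nonempty : initial.Nonempty
  act : γ.State i → Set {e : γ.Input // γ.observer e = i} → Set (γ.Msg × γ.Agent) → ℕ →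
    γ.Action i

/-- A joint protocol. -/
def Protocol (γ : Context.{u, v, w, x}) : Type (max u v w x) :=
  ∀ i : γ.Agent, γ.LocalProtocol i

/-- The delivery event of the message `msg`, sent by `src` to its neighbour `dst` at the time
`sentAt`. -/
structure Delivery (γ : Context.{u, v, w, x}) where
  msg : γ.Msg
  sentAt : ℕ
  src : γ.Agent
  dst : γ.Agent
  adj : γ.graph.Adj src dst

/-- A history: at every time, the set of events that take place (external inputs and message
deliveries) and the state of every agent, together with the initial states, which are the states
just before time `0`. -/
structure History (γ : Context.{u, v, w, x}) where
  initial : ∀ i : γ.Agent, γ.State i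
  inputs : ℕ → Set γ.Input
  deliveries : ℕ → Set γ.Delivery
  state : ℕ → ∀ i : γ.Agent, γ.State i

variable {γ : Context.{u, v, w, x}}

namespace History

/-- The state of `i` just before time `t`. -/
def stateBefore (r : γ.History) (i : γ.Agent) : ℕ → γ.State i
  | 0 => r.initial i
  | t + 1 => r.state t i

/-- The external inputs observed by `i` at time `t`. -/
def observedInputs (r : γ.History) (i : γ.Agent) (t : ℕ) :
    Set {e : γ.Input // γ.observer e = i} :=
  {e | e.1 ∈ r.inputs t}

/-- The messages, paired with their senders, that are delivered to `i` at time `t`. -/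
def observedMsgs (r : γ.History) (i : γ.Agent) (t : ℕ) : Set (γ.Msg × γ.Agent) :=
  {m | ∃ d ∈ r.deliveries t, d.dst = i ∧ d.msg = m.1 ∧ d.src = m.2}

/-- The action that the protocol `P` prescribes to `i` at time `t` in `r`. -/
def action (r : γ.History) (P : γ.Protocol) (i : γ.Agent) (t : ℕ) : γ.Action i :=
  (P i).act (r.stateBefore i t) (r.observedInputs i t) (r.observedMsgs i t) t

/-- The message that `d` delivers is indeed sent in `r`, by the agent, at the time and to the
neighbour that `d` specifies. -/
def Sent (r : γ.History) (P : γ.Protocol) (d : γ.Delivery) : Prop :=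
  (d.msg, ⟨d.dst, d.adj⟩) ∈ (r.action P d.src d.sentAt).sends

/-- `i` responds at time `t` in `r`. -/
def RespondsAt (r : γ.History) (P : γ.Protocol) (i : γ.Agent) (t : ℕ) : Prop :=
  (r.action P i t).responds

/-- The response time of `i` in `r`, which is `∞` if `i` does not respond in `r`. (It is used
only when `i` responds at most once.) -/
noncomputable def responseTime (r : γ.History) (P : γ.Protocol) (i : γ.Agent) : ℕ∞ :=
  sInf {T | ∃ t : ℕ, r.RespondsAt P i t ∧ (t : ℕ∞) = T}

/-- `r` is triggered by `e`. -/
def Triggered (r : γ.History) (e : γ.Input) : Prop := ∃ t, e ∈ r.inputs t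

end History

/-- `r` is a run of the protocol `P`. -/
structure IsRun (P : γ.Protocol) (r : γ.History) : Prop where
  initial_mem : ∀ i, r.initial i ∈ (P i).initial
  state_eq : ∀ i t, r.state t i = (r.action P i t).newState
  input_once : ∀ e t t', e ∈ r.inputs t → e ∈ r.inputs t' → t = t'
  /-- Every message sent is delivered exactly once, after it was sent and within its bound. -/
  delivered : ∀ d, r.Sent P d → ∃ t : ℕ, d.sentAt < t ∧
    (t : ℕ∞) ≤ (d.sentAt : ℕ∞) + γ.graph.weight d.src d.dst ∧
    ∀ t', d ∈ r.deliveries t' ↔ t' = t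
  sent_of_delivered : ∀ d t, d ∈ r.deliveries t → r.Sent P d

/-- Eventual response: in every triggered run each agent of `I` responds exactly once, and in
every other run no agent of `I` responds. -/
def ER (γ : Context.{u, v, w, x}) (e : γ.Input) (I : Set γ.Agent) : Set γ.Protocol :=
  {P | ∀ r, IsRun P r →
    (r.Triggered e → ∀ i ∈ I, ∃! t, r.RespondsAt P i t) ∧
    (¬ r.Triggered e → ∀ i ∈ I, ∀ t, ¬ r.RespondsAt P i t)}

/-- Simultaneous response. -/
def SR (γ : Context.{u, v, w, x}) (e : γ.Input) (I : Set γ.Agent) : Set γ.Protocol :=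
  {P | P ∈ γ.ER e I ∧ ∀ r, IsRun P r → ∃ T : ℕ∞, ∀ i ∈ I, r.responseTime P i = T}

end Context

/-- `t` implements the constraining function `δ` (whose values on the diagonal are ignored). -/
def IsImplementation {I : Type*} (δ : I → I → WithTop ℤ) (t : I → ℕ) : Prop :=
  ∀ i j, i ≠ j → (((t j : ℕ) : ℤ) : WithTop ℤ) ≤ (((t i : ℕ) : ℤ) : WithTop ℤ) + δ i j

/-- The weighted directed graph `G_δ` of a constraining function: its edges are the pairs of
distinct elements on which `δ` is finite. -/
def constraintGraph {I : Type*} (δ : I → I → WithTop ℤ) : WDigraph I (WithTop ℤ) where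
  Adj i j := i ≠ j ∧ δ i j ≠ ⊤
  weight := δ

namespace Context

/-- Timely-coordinated response: eventual response such that in every triggered run the response
times implement `δ`. -/
def TCR (γ : Context.{u, v, w, x}) (e : γ.Input) (I : Set γ.Agent) (δ : I → I → WithTop ℤ) :
    Set γ.Protocol :=
  {P | P ∈ γ.ER e I ∧ ∀ r, IsRun P r → r.Triggered e →
    ∃ t : I → ℕ, (∀ i : I, r.responseTime P i = t i) ∧ IsImplementation δ t}

/-- A problem, identified with the set of protocols solving it, is solvable if it is nonempty. -/
def Solvable {γ : Context.{u, v, w, x}} (CP : Set γ.Protocol) : Prop := CP.Nonempty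

/-- Some agent has finite bounded-delivery distance to every member of `J`. -/
def HasBoundedSource (γ : Context.{u, v, w, x}) (J : Set γ.Agent) : Prop :=
  ∃ i, ∀ j ∈ J, γ.graph.dist i j < ⊤

/-- For all strongly connected components `C 0, …, C n` of `G_δ` with a path in `G_δ` from each to
the next, there are agents `a 0, …, a n` such that the network has a path from the observer of
`e` through `a n`, `a (n - 1)`, …, to `a 0`, and `a m` has finite bounded-delivery distance to
every member of `C m`. -/
def ChainCondition (γ : Context.{u, v, w, x}) (e : γ.Input) (I : Set γ.Agent)
    (δ : I → I → WithTop ℤ) : Prop :=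
  ∀ (n : ℕ) (C : Fin (n + 1) → Set I),
    (∀ m, (constraintGraph δ).IsSCC (C m)) →
    (∀ m : Fin n, ∃ i ∈ C m.castSucc, ∃ j ∈ C m.succ, (constraintGraph δ).Reach i j) →
    ∃ a : Fin (n + 1) → γ.Agent,
      γ.graph.Reach (γ.observer e) (a (Fin.last n)) ∧
      (∀ m : Fin n, γ.graph.Reach (a m.succ) (a m.castSucc)) ∧
      ∀ m, ∀ j ∈ C m, γ.graph.dist (a m) (j : γ.Agent) < ⊤

end Context

/-! Everything reduces to one criterion, `solvable_TCR_iff`: without negative cycles, solvability of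
TCR is the chain condition. Simultaneous response is TCR for `δ = 0`, and for a strongly connected
constraint graph or network the chain condition collapses to the simpler conditions.

Necessity (`chainCondition_of_mem_TCR`) is an adversary argument. A schedule `D` of opportunities
controls when messages on unbounded edges arrive and whether `e` occurs. An edge of `G_δ` bounds the
later response from above, so a response of `i` under `D` forces one of `j` whatever happens
afterwards (`Responds.of_adj`). An agent notices the loss of the last opportunities in a forward
closed set only where they lie at finite distance to it (`responds_diff`). Within a component the
response passes to every member, so all opportunities at agents that are not bounded sources of the
component can be removed, latest first. If some chain of components had no relay agents, working
along it would remove even the triggering input while a response remains.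

Sufficiency (`solvable_TCR_of_chainCondition`) floods the network with activation times of the relay
agents of all chains of components. After a delay `B` exceeding all relevant bounded delays, the
members of a component agree on what has been activated, so they can compute a common time `τ`.
Agent `j` responds at `τ + φ j`, where `φ` is a potential of `G_δ`. The waiting rule `Ready` makes
`τ` nonincreasing along the edges of `G_δ`. -/

namespace WDigraph

/-! ### Paths, finite distances and potentials in weighted digraphs. -/

variable {V : Type*} {W : Type*} {G : WDigraph V W}

lemma IsPath.singleton (i : V) : G.IsPath i i [i] := by simp [IsPath]

lemma IsPath.cons {i j k : V} {p : List V} (h : G.Adj i j) (hp : G.IsPath j k p) :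
    G.IsPath i k (i :: p) := by
  obtain ⟨hc, hh, hl⟩ := hp
  cases p with
  | nil => simp at hh
  | cons a p =>
    obtain rfl : a = j := by simpa using hh
    exact ⟨List.isChain_cons_cons.2 ⟨h, hc⟩, rfl, by simpa using hl⟩

lemma IsPath.concat {i j k : V} {p : List V} (hp : G.IsPath i j p) (h : G.Adj j k) :
    G.IsPath i k (p ++ [k]) := by
  obtain ⟨hc, hh, hl⟩ := hp
  refine ⟨?_, ?_, by simp⟩
  · refine List.isChain_append.2 ⟨hc, by simp, ?_⟩
    intro a ha b hb
    simp_all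
  · cases p <;> simp_all

/-- A path is a single vertex, or an edge followed by a path. -/
lemma IsPath.cases {i k : V} {p : List V} (hp : G.IsPath i k p) :
    (p = [i] ∧ i = k) ∨ ∃ j q, p = i :: q ∧ G.Adj i j ∧ G.IsPath j k q := by
  obtain ⟨hc, hh, hl⟩ := hp
  match p with
  | [] => simp at hh
  | [a] => left; simp_all
  | a :: b :: q =>
    right
    obtain rfl : a = i := by simpa using hh
    rw [List.isChain_cons_cons] at hc
    exact ⟨b, b :: q, rfl, hc.1, hc.2, rfl, by simpa using hl⟩

lemma pathLength_cons [AddMonoid W] {i j k : V} {q : List V} (hq : G.IsPath j k q) :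
    G.pathLength (i :: q) = G.weight i j + G.pathLength q := by
  obtain ⟨-, hh, -⟩ := hq
  cases q with
  | nil => simp at hh
  | cons a q =>
    obtain rfl : a = j := by simpa using hh
    simp [pathLength]

lemma pathLength_append [AddMonoid W] (l : List V) (x : V) (l' : List V) :
    G.pathLength (l ++ x :: l') = G.pathLength (l ++ [x]) + G.pathLength (x :: l') := by
  induction l with
  | nil => simp [pathLength]
  | cons a l ih =>
    cases l with
    | nil => simp [pathLength]
    | cons b l =>
      simp only [pathLength, List.cons_append, List.tail_cons, List.zipWith_cons_cons,
        List.sum_cons, add_assoc] at ih ⊢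
      rw [ih]

lemma reach_iff {i j : V} : G.Reach i j ↔ Relation.ReflTransGen G.Adj i j := by
  constructor
  · rintro ⟨p, hp⟩
    induction p generalizing i with
    | nil => simp [IsPath] at hp
    | cons a p ih =>
      rcases hp.cases with ⟨-, rfl⟩ | ⟨k, q, hq, hk, hp'⟩
      · exact .refl
      · obtain ⟨rfl, rfl⟩ := List.cons.inj hq
        exact .head hk (ih hp')
  · intro h
    induction h using Relation.ReflTransGen.head_induction_on with
    | refl => exact ⟨[j], .singleton j⟩
    | head h _ ih =>
      obtain ⟨p, hp⟩ := ih
      exact ⟨_, hp.cons h⟩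

lemma Reach.refl (i : V) : G.Reach i i := reach_iff.2 .refl

lemma Reach.trans {i j k : V} (h : G.Reach i j) (h' : G.Reach j k) : G.Reach i k :=
  reach_iff.2 ((reach_iff.1 h).trans (reach_iff.1 h'))

lemma Reach.of_adj {i j : V} (h : G.Adj i j) : G.Reach i j := reach_iff.2 (.single h)

/-- A sum in `ℕ∞` is finite exactly when all its terms are. In this form finite distance can be
extended edge by edge. -/
lemma dist_lt_top_iff {G : WDigraph V ℕ∞} {i j : V} :
    G.dist i j < ⊤ ↔ Relation.ReflTransGen (fun a b => G.Adj a b ∧ G.weight a b < ⊤) i j := by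
  constructor
  · intro h
    obtain ⟨L, ⟨p, hp, rfl⟩, hL⟩ := sInf_lt_iff.1 h
    clear h
    induction p generalizing i with
    | nil => simp [IsPath] at hp
    | cons a p ih =>
      rcases hp.cases with ⟨-, rfl⟩ | ⟨k, q, hq, hk, hp'⟩
      · exact .refl
      · obtain ⟨rfl, rfl⟩ := List.cons.inj hq
        rw [pathLength_cons hp', ENat.add_lt_top] at hL
        exact .head ⟨hk, hL.1⟩ (ih hp' hL.2)
  · intro h
    suffices ∃ p, G.IsPath i j p ∧ G.pathLength p < ⊤ by
      obtain ⟨p, hp, hL⟩ := this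
      exact sInf_lt_iff.2 ⟨_, ⟨p, hp, rfl⟩, hL⟩
    induction h using Relation.ReflTransGen.head_induction_on with
    | refl => exact ⟨[j], .singleton j, by simp [pathLength]⟩
    | head h _ ih =>
      obtain ⟨p, hp, hL⟩ := ih
      exact ⟨_, hp.cons h.1, by rw [pathLength_cons hp]; exact ENat.add_lt_top.2 ⟨h.2, hL⟩⟩

/-- The strongly connected component of a vertex. -/
def scc (G : WDigraph V W) (i : V) : Set V := {j | G.Reach i j ∧ G.Reach j i}

lemma isSCC_scc (i : V) : G.IsSCC (G.scc i) := ⟨i, rfl⟩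

lemma mem_scc_self (i : V) : i ∈ G.scc i := ⟨.refl i, .refl i⟩

lemma IsSCC.reach {J : Set V} (hJ : G.IsSCC J) {i j : V} (hi : i ∈ J) (hj : j ∈ J) :
    G.Reach i j := by
  obtain ⟨k, rfl⟩ := hJ
  exact hi.2.trans hj.1

/-- Without negative cycles, every path can be shortened to a simple one. -/
lemma NoNegCycle.exists_nodup {G : WDigraph V (WithTop ℤ)} (hG : G.NoNegCycle) {i j : V}
    {p : List V} (hp : G.IsPath i j p) :
    ∃ q, q.Nodup ∧ G.IsPath i j q ∧ G.pathLength q ≤ G.pathLength p := by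
  induction hn : p.length using Nat.strong_induction_on generalizing p with
  | _ n ih =>
    by_cases hnd : p.Nodup
    · exact ⟨p, hnd, hp, le_rfl⟩
    obtain ⟨x, hx⟩ := List.exists_duplicate_iff_not_nodup.2 hnd
    obtain ⟨l₁, l', rfl, hx'⟩ : ∃ l₁ l', p = l₁ ++ x :: l' ∧ x ∈ l' := by
      clear hp ih hn hnd
      induction hx with
      | cons_mem h => exact ⟨[], _, rfl, h⟩
      | cons_duplicate _ ih =>
        obtain ⟨l₁, l', rfl, h⟩ := ih
        exact ⟨_ :: l₁, l', rfl, h⟩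
    obtain ⟨l₂, l₃, rfl⟩ := List.append_of_mem hx'
    obtain ⟨hc, hh, hl⟩ := hp
    have h1 := List.isChain_append.1 hc
    have h2 : (x :: l₂ ++ x :: l₃).IsChain G.Adj := h1.2.1
    have h3 := List.isChain_append.1 h2
    -- Cutting out the closed segment `x l₂ x`, of nonnegative length, does not lengthen the path.
    have hcyc : G.IsPath x x (x :: l₂ ++ [x]) := by
      refine ⟨List.isChain_append.2 ⟨h3.1, by simp, ?_⟩, rfl, by rw [List.getLast?_append]; rfl⟩
      intro a ha b hb
      exact h3.2.2 a ha b (by simpa using hb)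
    have hq : G.IsPath i j (l₁ ++ x :: l₃) := by
      refine ⟨List.isChain_append.2 ⟨h1.1, h3.2.1, ?_⟩, ?_, ?_⟩
      · intro a ha b hb
        exact h1.2.2 a ha b (by simpa using hb)
      · cases l₁ <;> simpa using hh
      · simpa [List.getLast?_append, List.getLast?_cons] using hl
    obtain ⟨q, hq1, hq2, hq3⟩ := ih _ (by simp at hn ⊢; omega) hq rfl
    refine ⟨q, hq1, hq2, hq3.trans ?_⟩
    have e1 := pathLength_append (G := G) l₁ x (l₂ ++ x :: l₃)
    have e2 : G.pathLength (x :: (l₂ ++ x :: l₃)) = _ := pathLength_append (G := G) (x :: l₂) x l₃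
    rw [e1, e2, pathLength_append l₁ x l₃]
    have := not_lt.1 (hG x _ hcyc)
    gcongr
    exact le_add_of_nonneg_left this

/-- A finite graph without negative cycles has a potential. -/
lemma NoNegCycle.exists_potential [Finite V] {G : WDigraph V (WithTop ℤ)} (hG : G.NoNegCycle) :
    ∃ φ : V → ℕ, ∀ i j, G.Adj i j →
      (((φ j : ℕ) : ℤ) : WithTop ℤ) ≤ (((φ i : ℕ) : ℤ) : WithTop ℤ) + G.weight i j := by
  classical
  have := Fintype.ofFinite V
  let S : V → Set (List V) := fun j => {p | p.Nodup ∧ ∃ i, G.IsPath i j p}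
  have hS : ∀ j, (S j).Finite := fun j =>
    (Set.finite_coe_iff.1 (inferInstanceAs (Finite {p : List V // p.Nodup}))).subset fun p hp => hp.1
  have hne : ∀ j, (S j).Nonempty := fun j => ⟨[j], by simp, j, .singleton j⟩
  -- The potential at `j` is the least length of a simple path ending at `j`, with free starting
  -- point. The path `[j]` shows that it is at most `0`, hence finite.
  choose p hp hmin using fun j => Set.exists_min_image (S j) G.pathLength (hS j) (hne j)
  have hle : ∀ j, G.pathLength (p j) ≤ 0 := fun j => by
    simpa [pathLength] using hmin j [j] ⟨by simp, j, .singleton j⟩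
  have hz : ∀ j, ∃ z : ℤ, (z : WithTop ℤ) = G.pathLength (p j) := fun j =>
    WithTop.ne_top_iff_exists.1 ((hle j).trans_lt (WithTop.coe_lt_top 0)).ne
  choose z hz using hz
  have key : ∀ i j, G.Adj i j → ((z j : ℤ) : WithTop ℤ) ≤ (z i : ℤ) + G.weight i j := by
    intro i j hij
    obtain ⟨-, k, hk⟩ := hp i
    obtain ⟨q, hq1, hq2, hq3⟩ := hG.exists_nodup (hk.concat hij)
    rw [hz, hz]
    refine (hmin j q ⟨hq1, k, hq2⟩).trans (hq3.trans_eq ?_)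
    obtain ⟨-, -, hl⟩ := hk
    obtain ⟨l, hl⟩ := List.getLast?_eq_some_iff.1 hl
    rw [hl, List.append_assoc, List.singleton_append, pathLength_append]
    simp [pathLength]
  obtain ⟨m, hm⟩ : ∃ m : ℤ, ∀ j, m ≤ z j := by
    obtain ⟨m, hm⟩ := (Set.finite_range z).bddBelow
    exact ⟨m, fun j => hm ⟨j, rfl⟩⟩
  -- Subtracting a lower bound makes the values nonnegative, so `toNat` loses nothing.
  refine ⟨fun j => (z j - m).toNat, fun i j hij => ?_⟩
  rw [Int.toNat_of_nonneg (by linarith [hm j]), Int.toNat_of_nonneg (by linarith [hm i])]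
  have := key i j hij
  cases hw : G.weight i j with
  | top => simp
  | coe w =>
    rw [hw] at this
    norm_cast at this ⊢
    linarith

end WDigraph

/-! ### Runs controlled by schedules of opportunities. -/

namespace Context

variable {γ : Context.{u, v, w, x}}

/-- When the message `d` is delivered in the schedule `D`: with the maximal delay on an edge of
finite weight, and at the first opportunity that `D` gives to the recipient on an edge of infinite
weight. -/
def Due (D : Set (γ.Agent × ℕ)) (d : γ.Delivery) (t : ℕ) : Prop :=
  d.sentAt < t ∧
    ((t : ℕ∞) = d.sentAt + γ.graph.weight d.src d.dst ∨
      γ.graph.weight d.src d.dst = ⊤ ∧ (d.dst, t) ∈ D ∧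
        ∀ t', d.sentAt < t' → t' < t → (d.dst, t') ∉ D)

/-- The external inputs in the schedule `D`: only `e`, at time `0`, and only if `D` allows it. -/
def scheduledInputs (e : γ.Input) (D : Set (γ.Agent × ℕ)) (t : ℕ) : Set γ.Input :=
  {e' | e' = e ∧ t = 0 ∧ (γ.observer e, 0) ∈ D}

/-- The states just before time `t`, and the messages sent before time `t`. -/
noncomputable def scheduledStep (P : γ.Protocol) (e : γ.Input) (D : Set (γ.Agent × ℕ)) :
    ℕ → (∀ i, γ.State i) × Set γ.Delivery
  | 0 => (fun i => (P i).initial_nonempty.some, ∅)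
  | t + 1 =>
    let s := scheduledStep P e D t
    let act := fun i => (P i).act (s.1 i) {e' | e'.1 ∈ scheduledInputs e D t}
      {m | ∃ d ∈ {d | d ∈ s.2 ∧ Due D d t}, d.dst = i ∧ d.msg = m.1 ∧ d.src = m.2} t
    (fun i => (act i).newState,
      s.2 ∪ {d | d.sentAt = t ∧ (d.msg, ⟨d.dst, d.adj⟩) ∈ (act d.src).sends})

/-- The history in which the agents follow `P` and events take place according to `D`. It is a run
if `D` gives every agent infinitely many opportunities. -/
noncomputable def scheduled (P : γ.Protocol) (e : γ.Input) (D : Set (γ.Agent × ℕ)) :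
    γ.History where
  initial i := (P i).initial_nonempty.some
  inputs := scheduledInputs e D
  deliveries t := {d | d ∈ (scheduledStep P e D t).2 ∧ Due D d t}
  state t := (scheduledStep P e D (t + 1)).1

variable {P : γ.Protocol} {e : γ.Input} {D D' : Set (γ.Agent × ℕ)}

lemma scheduled_stateBefore (i : γ.Agent) (t : ℕ) :
    (scheduled P e D).stateBefore i t = (scheduledStep P e D t).1 i := by
  cases t <;> rfl

lemma scheduled_state_eq (i : γ.Agent) (t : ℕ) :
    (scheduled P e D).state t i = ((scheduled P e D).action P i t).newState := by
  unfold History.action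
  rw [scheduled_stateBefore]
  rfl

lemma mem_scheduledStep_succ (d : γ.Delivery) (t : ℕ) :
    d ∈ (scheduledStep P e D (t + 1)).2 ↔
      d ∈ (scheduledStep P e D t).2 ∨ d.sentAt = t ∧ (scheduled P e D).Sent P d := by
  have h : d ∈ (scheduledStep P e D (t + 1)).2 ↔ d ∈ (scheduledStep P e D t).2 ∨
      d.sentAt = t ∧ (d.msg, ⟨d.dst, d.adj⟩) ∈ ((scheduled P e D).action P d.src t).sends := by
    unfold History.action
    rw [scheduled_stateBefore]
    rfl
  rw [h]
  refine or_congr_right (and_congr_right ?_)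
  rintro rfl
  rfl

lemma mem_scheduledStep (d : γ.Delivery) (t : ℕ) :
    d ∈ (scheduledStep P e D t).2 ↔ d.sentAt < t ∧ (scheduled P e D).Sent P d := by
  induction t with
  | zero => simp [scheduledStep]
  | succ t ih =>
    rw [mem_scheduledStep_succ, ih, ← or_and_right, ← le_iff_lt_or_eq, Nat.lt_succ_iff]

lemma mem_scheduled_deliveries (d : γ.Delivery) (t : ℕ) :
    d ∈ (scheduled P e D).deliveries t ↔ (scheduled P e D).Sent P d ∧ Due D d t := by
  change d ∈ (scheduledStep P e D t).2 ∧ Due D d t ↔ _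
  rw [mem_scheduledStep]
  exact ⟨fun h => ⟨h.1.2, h.2⟩, fun h => ⟨⟨h.2.1, h.1⟩, h.2⟩⟩

lemma Due.unique {d : γ.Delivery} {t t' : ℕ} (h : Due D d t) (h' : Due D d t') : t = t' := by
  obtain ⟨h1, h2⟩ := h
  obtain ⟨h1', h2'⟩ := h'
  rcases h2 with h2 | ⟨hw, hD, hf⟩ <;> rcases h2' with h2' | ⟨hw', hD', hf'⟩
  · exact_mod_cast h2.trans h2'.symm
  · rw [hw'] at h2; simp at h2
  · rw [hw] at h2'; simp at h2'
  · rcases lt_trichotomy t t' with h | h | h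
    · exact absurd hD (hf' t h1 h)
    · exact h
    · exact absurd hD' (hf t' h1' h)

lemma Due.exists (hD : ∀ i t, ∃ t', t < t' ∧ (i, t') ∈ D) (d : γ.Delivery) : ∃ t, Due D d t := by
  classical
  cases hw : γ.graph.weight d.src d.dst with
  | top =>
    have h := hD d.dst d.sentAt
    refine ⟨Nat.find h, (Nat.find_spec h).1, .inr ⟨hw, (Nat.find_spec h).2, ?_⟩⟩
    intro t' h1 h2 h3
    exact Nat.find_min h h2 ⟨h1, h3⟩
  | coe b =>
    have := γ.weight_pos _ _ d.adj
    rw [hw] at this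
    have hb : 0 < b := by exact_mod_cast this
    exact ⟨d.sentAt + b, by omega, .inl (by rw [hw]; norm_cast)⟩

lemma isRun_scheduled (hD : ∀ i t, ∃ t', t < t' ∧ (i, t') ∈ D) : IsRun P (scheduled P e D) where
  initial_mem i := (P i).initial_nonempty.some_mem
  state_eq := scheduled_state_eq
  input_once := by
    rintro e' t t' ⟨-, rfl, -⟩ ⟨-, rfl, -⟩
    rfl
  delivered d hd := by
    obtain ⟨t, ht⟩ := Due.exists hD d
    refine ⟨t, ht.1, ?_, fun t' => ?_⟩
    · rcases ht.2 with h | ⟨h, -⟩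
      · exact h.le
      · simp [h]
    · rw [mem_scheduled_deliveries]
      exact ⟨fun h => h.2.unique ht, by rintro rfl; exact ⟨hd, ht⟩⟩
  sent_of_delivered d t h := ((mem_scheduled_deliveries d t).1 h).1

lemma scheduled_triggered_iff : (scheduled P e D).Triggered e ↔ (γ.observer e, 0) ∈ D := by
  constructor
  · rintro ⟨t, -, -, h⟩
    exact h
  · exact fun h => ⟨0, rfl, rfl, h⟩

/-- Two schedules that agree on a set of nodes closed under the past give rise to the same actions
at these nodes. -/
lemma scheduled_action_congr {Safe : γ.Agent → ℕ → Prop}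
    (hdown : ∀ k t t', t' ≤ t → Safe k t → Safe k t')
    (hagree : ∀ k t, Safe k t → ((k, t) ∈ D ↔ (k, t) ∈ D'))
    (hpast : ∀ d : γ.Delivery, ∀ t, Safe d.dst t → Due D d t → Safe d.src d.sentAt)
    (k : γ.Agent) (t : ℕ) (hk : Safe k t) :
    (scheduled P e D).action P k t = (scheduled P e D').action P k t := by
  -- Whether a message is due at `t` depends only on its recipient's opportunities up to `t`, all of
  -- which are safe.
  have hdue : ∀ d : γ.Delivery, ∀ t, Safe d.dst t → (Due D d t ↔ Due D' d t) := by
    intro d t h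
    refine and_congr_right fun _ => or_congr_right (and_congr_right fun _ => ?_)
    refine and_congr (hagree _ _ h) ?_
    refine forall_congr' fun t' => forall_congr' fun _ => forall_congr' fun h' => ?_
    exact not_congr (hagree _ _ (hdown _ _ _ h'.le h))
  induction t using Nat.strong_induction_on generalizing k with
  | _ t ih =>
    have h1 : (scheduled P e D).stateBefore k t = (scheduled P e D').stateBefore k t := by
      cases t with
      | zero => rfl
      | succ t =>
        change (scheduled P e D).state t k = (scheduled P e D').state t k
        rw [scheduled_state_eq, scheduled_state_eq,
          ih t (Nat.lt_succ_self t) k (hdown _ _ _ (Nat.le_succ t) hk)]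
    have h2 : (scheduled P e D).observedInputs k t = (scheduled P e D').observedInputs k t := by
      ext ⟨e', he'⟩
      refine and_congr_right fun h => and_congr_right fun ht => ?_
      dsimp only at h
      subst h ht
      rw [he']
      exact hagree _ _ hk
    have h3 : (scheduled P e D).observedMsgs k t = (scheduled P e D').observedMsgs k t := by
      ext m
      refine exists_congr fun d => ?_
      rw [mem_scheduled_deliveries, mem_scheduled_deliveries]
      constructor
      · rintro ⟨⟨hs, hd⟩, rfl, h⟩
        refine ⟨⟨?_, (hdue d t hk).1 hd⟩, rfl, h⟩
        unfold History.Sent at hs ⊢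
        rwa [← ih _ hd.1 _ (hpast d t hk hd)]
      · rintro ⟨⟨hs, hd⟩, rfl, h⟩
        replace hd := (hdue d t hk).2 hd
        refine ⟨⟨?_, hd⟩, rfl, h⟩
        unfold History.Sent at hs ⊢
        rwa [ih _ hd.1 _ (hpast d t hk hd)]
    unfold History.action
    rw [h1, h2, h3]

/-- Actions up to time `H` depend only on the schedule up to time `H`. -/
lemma scheduled_action_truncate {H : ℕ} (k : γ.Agent) {t : ℕ} (ht : t ≤ H) :
    (scheduled P e D).action P k t =
      (scheduled P e (D ∪ {n | H < n.2})).action P k t := by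
  refine scheduled_action_congr (Safe := fun _ t => t ≤ H) (fun _ _ _ h h' => h.trans h') ?_
    (fun d t h h' => h'.1.le.trans h) k t ht
  intro k t h
  simp [h]

/-! ### Necessity: responses that survive the removal of opportunities. -/

lemma responseTime_eq {r : γ.History} {i : γ.Agent} {t : ℕ} (h : ∃! t, r.RespondsAt P i t)
    (ht : r.RespondsAt P i t) : r.responseTime P i = t := by
  have : {T : ℕ∞ | ∃ t : ℕ, r.RespondsAt P i t ∧ (t : ℕ∞) = T} = {(t : ℕ∞)} := by
    ext T
    constructor
    · rintro ⟨t', h', rfl⟩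
      rw [h.unique h' ht]
      rfl
    · rintro rfl
      exact ⟨t, ht, rfl⟩
  rw [History.responseTime, this, sInf_singleton]

/-- `i` responds in the history with the schedule `D`. -/
def Responds (P : γ.Protocol) (e : γ.Input) (D : Set (γ.Agent × ℕ)) (i : γ.Agent) : Prop :=
  ∃ t, (scheduled P e D).RespondsAt P i t

/-- An arbitrary schedule may starve agents and so fail to give a run; granting all opportunities
after `H` repairs this without affecting actions up to `H`. -/
lemma isRun_truncate (H : ℕ) : IsRun P (scheduled P e (D ∪ {n | H < n.2})) := by
  refine isRun_scheduled fun i t => ⟨max t H + 1, by omega, .inr ?_⟩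
  change H < max t H + 1
  omega

variable {I : Set γ.Agent}

lemma Responds.observer_mem (hP : P ∈ γ.ER e I) {i : γ.Agent} (hi : i ∈ I)
    (h : Responds P e D i) : (γ.observer e, 0) ∈ D := by
  obtain ⟨t, ht⟩ := h
  by_contra hD
  refine ((hP _ (isRun_truncate (e := e) (D := D) t)).2 ?_) i hi t ?_
  · rw [scheduled_triggered_iff]
    simpa using hD
  · unfold History.RespondsAt at ht ⊢
    rwa [← scheduled_action_truncate _ le_rfl]

lemma Responds.of_adj {δ : I → I → WithTop ℤ} (hP : P ∈ γ.TCR e I δ) {i j : I}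
    (hij : (constraintGraph δ).Adj i j) (h : Responds P e D i) : Responds P e D j := by
  have hD := h.observer_mem hP.1 i.2
  obtain ⟨t, ht⟩ := h
  obtain ⟨w, hw⟩ := WithTop.ne_top_iff_exists.1 hij.2
  -- Both responses fall at or before `H`, also for negative `w`, so the opportunities added after
  -- `H` affect neither.
  set H := t + w.toNat with hH
  have hr := isRun_truncate (P := P) (e := e) (D := D) H
  have htr : (scheduled P e (D ∪ {n | H < n.2})).Triggered e :=
    scheduled_triggered_iff.2 (.inl hD)
  obtain ⟨τ, hτ, himp⟩ := hP.2 _ hr htr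
  have hER := (hP.1 _ hr).1 htr
  have hi : (scheduled P e (D ∪ {n | H < n.2})).RespondsAt P i t := by
    unfold History.RespondsAt at ht ⊢
    rwa [← scheduled_action_truncate _ (Nat.le_add_right _ _)]
  obtain ⟨t', ht', -⟩ := hER j j.2
  have e1 := (hτ i).symm.trans (responseTime_eq (hER i i.2) hi)
  have e2 := (hτ j).symm.trans (responseTime_eq (hER j j.2) ht')
  have e1' : τ i = t := by exact_mod_cast e1
  have e2' : τ j = t' := by exact_mod_cast e2
  have := himp i j hij.1
  rw [e1', e2', ← hw] at this
  have hle : (t' : ℤ) ≤ t + w := by exact_mod_cast this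
  refine ⟨t', ?_⟩
  unfold History.RespondsAt at ht' ⊢
  rwa [scheduled_action_truncate (H := H) _ (by omega)]

lemma Responds.of_reach {δ : I → I → WithTop ℤ} (hP : P ∈ γ.TCR e I δ) {i j : I}
    (hij : (constraintGraph δ).Reach i j) (h : Responds P e D i) : Responds P e D j := by
  rw [WDigraph.reach_iff] at hij
  induction hij with
  | refl => exact h
  | tail _ h' ih => exact ih.of_adj hP h'

lemma exists_responds (hP : P ∈ γ.ER e I) {i : γ.Agent} (hi : i ∈ I) :
    ∃ T, Responds P e {n | n.2 ≤ T} i := by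
  have hr : IsRun P (scheduled P e Set.univ) :=
    isRun_scheduled fun _ t => ⟨t + 1, by omega, trivial⟩
  obtain ⟨t, ht, -⟩ := (hP _ hr).1 (scheduled_triggered_iff.2 trivial) i hi
  refine ⟨t, t, ?_⟩
  have : ({n | n.2 ≤ t} ∪ {n | t < n.2} : Set (γ.Agent × ℕ)) = Set.univ := by
    ext n
    simp [le_or_gt]
  unfold History.RespondsAt at ht ⊢
  rwa [scheduled_action_truncate (H := t) _ le_rfl, this]

/-- An agent `j` does not notice the removal of opportunities, at the last time at which they
exist within a forward closed set `U`, from agents in `U` at infinite distance to `j`. -/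
lemma responds_diff {U : Set γ.Agent} (hU : ∀ a b, γ.graph.Adj a b → a ∈ U → b ∈ U) {s : ℕ}
    (hs : ∀ a ∈ U, ∀ t, s < t → (a, t) ∉ D) {j : γ.Agent} (h : Responds P e D j) :
    Responds P e (D \ {n | n.1 ∈ U ∧ n.2 = s ∧ ¬ γ.graph.dist n.1 j < ⊤}) j := by
  obtain ⟨t, ht⟩ := h
  refine ⟨t, ?_⟩
  unfold History.RespondsAt at ht ⊢
  -- The unsafe nodes are those in `U`, at infinite distance to `j`, from time `s` on. They cannot
  -- influence safe ones: a message sent there stays in `U`, where no opportunity comes after `s`,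
  -- so it arrives over a bounded edge, and such an edge keeps the distance to `j` infinite. All
  -- nodes of `j` itself are safe.
  rwa [← scheduled_action_congr (D := D)
    (Safe := fun k t => k ∈ U → ¬ γ.graph.dist k j < ⊤ → t < s)]
  · intro k t t' h1 h2 h3 h4
    exact h1.trans_lt (h2 h3 h4)
  · intro k t hk
    refine ⟨fun h => ⟨h, fun h' => ?_⟩, fun h => h.1⟩
    obtain ⟨h1, h2, h3⟩ := h'
    have := hk h1 h3
    dsimp only at h2
    omega
  · intro d t hd hdue h1 h2
    have hdst := hU _ _ d.adj h1
    by_contra hlt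
    have hst : s < t := by have := hdue.1; omega
    by_cases hj : γ.graph.dist d.dst j < ⊤
    · rcases hdue.2 with hw | ⟨-, hD, -⟩
      · refine h2 (WDigraph.dist_lt_top_iff.2 (.head ⟨d.adj, ?_⟩ (WDigraph.dist_lt_top_iff.1 hj)))
        refine lt_top_iff_ne_top.2 fun h => ?_
        rw [h] at hw
        simp at hw
      · exact hs _ hdst _ hst hD
    · have := hd hdst hj
      omega
  · intro _ h
    refine absurd ?_ h
    exact WDigraph.dist_lt_top_iff.2 .refl

/-- Members of a strongly connected component `C` do not notice the removal of all opportunities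
from agents without finite distance to all of `C`. -/
lemma responds_diff_of_isSCC {δ : I → I → WithTop ℤ} (hI : I.Finite) (hP : P ∈ γ.TCR e I δ)
    {C : Set I} (hC : (constraintGraph δ).IsSCC C)
    {U : Set γ.Agent} (hU : ∀ a b, γ.graph.Adj a b → a ∈ U → b ∈ U) {T : ℕ}
    (hT : ∀ n ∈ D, n.2 ≤ T)
    (hfar : ∀ n ∈ D, n.1 ∈ U → ∃ j ∈ C, ¬ γ.graph.dist n.1 j < ⊤)
    (h : ∃ i ∈ C, Responds P e D i) :
    ∃ i ∈ C, Responds P e (D \ {n | n.1 ∈ U}) i := by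
  classical
  have : Finite I := hI
  have step : ∀ (s : ℕ) (D : Set (γ.Agent × ℕ)), (∀ a ∈ U, ∀ t, s < t → (a, t) ∉ D) →
      (∃ i ∈ C, Responds P e D i) →
      (∃ i ∈ C, Responds P e
        (D \ {n | n.1 ∈ U ∧ n.2 = s ∧ ∃ j ∈ C, ¬ γ.graph.dist n.1 j < ⊤}) i) := by
    intro s D hs h
    -- The members of `C` are treated one at a time: the response moves to `j` inside `C`, after
    -- which opportunities at infinite distance to `j` can go.
    have aux : ∀ J : Finset I, (∀ j ∈ J, j ∈ C) → ∃ i ∈ C, Responds P e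
        (D \ {n | n.1 ∈ U ∧ n.2 = s ∧ ∃ j ∈ J, ¬ γ.graph.dist n.1 j < ⊤}) i := by
      intro J
      induction J using Finset.induction_on with
      | empty => simpa using h
      | insert j J hj ih =>
        intro hJ
        obtain ⟨i, hi, hri⟩ := ih fun k hk => hJ k (Finset.mem_insert_of_mem hk)
        have hjC : j ∈ C := hJ j (Finset.mem_insert_self _ _)
        refine ⟨j, hjC, ?_⟩
        have hrj := hri.of_reach hP (hC.reach hi hjC)
        have := responds_diff hU (s := s) (fun a ha t ht h' => hs a ha t ht h'.1) hrj
        convert this using 1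
        ext n
        simp only [Set.mem_sdiff, Set.mem_ofPred_eq, Finset.mem_insert, exists_eq_or_imp]
        generalize (∃ a ∈ J, ¬ γ.graph.dist n.1 a < ⊤) = q
        tauto
    obtain ⟨i, hi, hr⟩ := aux C.toFinite.toFinset (by simp)
    exact ⟨i, hi, by simpa using hr⟩
  -- Removal runs backwards in time, so that at each stage `U` has no later opportunities left, as
  -- `responds_diff` demands.
  have main : ∀ s ≤ T + 1, ∃ i ∈ C, Responds P e (D \ {n | n.1 ∈ U ∧ T + 1 - s ≤ n.2}) i := by
    intro s
    induction s with
    | zero =>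
      intro _
      convert h using 4
      ext n
      simp only [Set.mem_sdiff, Set.mem_ofPred_eq, and_iff_left_iff_imp]
      intro hn h'
      have := hT n hn
      omega
    | succ s ih =>
      intro hs
      have := step (T - s) _ ?_ (ih (by omega))
      · convert this using 4
        ext n
        simp only [Set.mem_sdiff, Set.mem_ofPred_eq]
        constructor
        · rintro ⟨h1, h2⟩
          refine ⟨⟨h1, fun h => h2 ⟨h.1, by omega⟩⟩, fun h => h2 ⟨h.1, by omega⟩⟩
        · rintro ⟨⟨h1, h2⟩, h3⟩
          refine ⟨h1, fun h => ?_⟩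
          by_cases hn : n.2 = T - s
          · exact h3 ⟨h.1, hn, hfar n h1 h.1⟩
          · exact h2 ⟨h.1, by omega⟩
      · intro a ha t ht h
        refine h.2 ⟨ha, ?_⟩
        dsimp only
        omega
  simpa using main (T + 1) le_rfl

/-- The agents reachable from the observer of `e` through agents with finite distance to all of
`C 0`, then to all of `C 1`, …, then to all of `C (k - 1)`. -/
def relayed (e : γ.Input) (C : ℕ → Set γ.Agent) : ℕ → Set γ.Agent
  | 0 => {b | γ.graph.Reach (γ.observer e) b}
  | k + 1 => {b | ∃ a ∈ relayed e C k, (∀ j ∈ C k, γ.graph.dist a j < ⊤) ∧ γ.graph.Reach a b}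

lemma relayed_forward (C : ℕ → Set γ.Agent) (k : ℕ) (a b : γ.Agent) (h : γ.graph.Adj a b)
    (ha : a ∈ relayed e C k) : b ∈ relayed e C k := by
  cases k with
  | zero => exact WDigraph.Reach.trans ha (.of_adj h)
  | succ k =>
    obtain ⟨a', h1, h2, h3⟩ := ha
    exact ⟨a', h1, h2, h3.trans (.of_adj h)⟩

lemma exists_relay (C : ℕ → Set γ.Agent) (k : ℕ) (b : γ.Agent)
    (hb : b ∈ relayed e C (k + 1)) : ∃ a : ℕ → γ.Agent, γ.graph.Reach (γ.observer e) (a 0) ∧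
      (∀ m < k, γ.graph.Reach (a m) (a (m + 1))) ∧ (∀ m ≤ k, ∀ j ∈ C m, γ.graph.dist (a m) j < ⊤) ∧
      γ.graph.Reach (a k) b := by
  induction k generalizing b with
  | zero =>
    obtain ⟨a, h1, h2, h3⟩ := hb
    refine ⟨fun _ => a, h1, by simp, ?_, h3⟩
    intro m hm
    obtain rfl : m = 0 := by omega
    exact h2
  | succ k ih =>
    obtain ⟨a', h1, h2, h3⟩ := hb
    obtain ⟨a, g1, g2, g3, g4⟩ := ih a' h1
    refine ⟨fun m => if m ≤ k then a m else a', by simpa using g1, ?_, ?_, by simpa using h3⟩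
    · intro m hm
      rcases Nat.lt_or_ge m k with h | h
      · simpa [h.le, Nat.succ_le_of_lt h] using g2 m h
      · obtain rfl : m = k := by omega
        simpa using g4
    · intro m hm
      rcases Nat.lt_or_ge k m with h | h
      · obtain rfl : m = k + 1 := by omega
        simpa using h2
      · simpa [h] using g3 m h

theorem chainCondition_of_mem_TCR {δ : I → I → WithTop ℤ} (hI : I.Finite)
    (hP : P ∈ γ.TCR e I δ) : γ.ChainCondition e I δ := by
  intro n C hC hstep
  -- Network paths run against the order of the chain, so relays are counted from the last
  -- component.
  let C' : ℕ → Set I := fun k => C (Fin.rev (Fin.ofNat (n + 1) k))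
  let S : ℕ → Set γ.Agent := fun k => Subtype.val '' C' k
  have hC'k : ∀ (m : Fin (n + 1)), C' (n - m) = C m := by
    intro m
    change C _ = C m
    congr 1
    ext
    simp only [Fin.val_rev, Fin.ofNat]
    rw [Nat.mod_eq_of_lt (by omega)]
    omega
  suffices hne : (relayed e S (n + 1)).Nonempty by
    obtain ⟨b, hb⟩ := hne
    obtain ⟨a, h1, h2, h3, -⟩ := exists_relay S n b hb
    refine ⟨fun m => a (n - m), by simpa using h1, ?_, ?_⟩
    · intro m
      have := h2 (n - (m + 1)) (by omega)
      have e1 : n - (m + 1) + 1 = n - (m : ℕ) := by omega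
      rw [e1] at this
      simpa using this
    · intro m j hj
      refine h3 (n - m) (by omega) j ⟨j, ?_, rfl⟩
      rw [hC'k]
      exact hj
  by_contra hne
  rw [Set.not_nonempty_iff_eq_empty] at hne
  have hstep' : ∀ k < n, ∃ i ∈ C' (k + 1), ∃ j ∈ C' k, (constraintGraph δ).Reach i j := by
    intro k hk
    obtain ⟨i, hi, j, hj, h⟩ := hstep ⟨n - (k + 1), by omega⟩
    rw [← hC'k] at hi hj
    refine ⟨i, ?_, j, ?_, h⟩
    · convert hi using 2
      simp only [Fin.val_castSucc]
      omega
    · convert hj using 2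
      simp only [Fin.val_succ]
      omega
  -- If `D` avoids `relayed e S (k + 1)`, its nodes in `relayed e S k` are not bounded sources of
  -- `C' k`, so they can be removed. The response then passes to `C' (k - 1)`. At `k = 0` the
  -- observer loses its opportunity at time `0`, so a response occurs untriggered.
  have key : ∀ k ≤ n, ∀ (T : ℕ) (D : Set (γ.Agent × ℕ)), (∀ n ∈ D, n.2 ≤ T) →
      (∀ n ∈ D, n.1 ∉ relayed e S (k + 1)) → (∃ i ∈ C' k, Responds P e D i) → False := by
    intro k
    induction k with
    | zero =>
      intro _ T D hT hD hr
      have hfar : ∀ n ∈ D, n.1 ∈ relayed e S 0 → ∃ j ∈ C' 0, ¬ γ.graph.dist n.1 j < ⊤ := by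
        intro n hn hn0
        by_contra! hfar
        refine hD n hn ⟨n.1, hn0, ?_, .refl _⟩
        rintro _ ⟨j, hj, rfl⟩
        exact hfar j hj
      obtain ⟨i, -, h⟩ := responds_diff_of_isSCC hI hP (hC _) (relayed_forward S 0) hT hfar hr
      exact (h.observer_mem hP.1 i.2).2 (WDigraph.Reach.refl _)
    | succ k ih =>
      intro hk T D hT hD hr
      have hfar : ∀ n ∈ D, n.1 ∈ relayed e S (k + 1) →
          ∃ j ∈ C' (k + 1), ¬ γ.graph.dist n.1 j < ⊤ := by
        intro n hn hn0
        by_contra! hfar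
        refine hD n hn ⟨n.1, hn0, ?_, .refl _⟩
        rintro _ ⟨j, hj, rfl⟩
        exact hfar j hj
      obtain ⟨i, hi, h⟩ :=
        responds_diff_of_isSCC hI hP (hC _) (relayed_forward S (k + 1)) hT hfar hr
      obtain ⟨i', hi', j, hj, hij⟩ := hstep' k (by omega)
      refine ih (by omega) T (D \ {n | n.1 ∈ relayed e S (k + 1)}) (fun n hn => hT n hn.1)
        (fun n hn => hn.2) ⟨j, hj, ?_⟩
      exact h.of_reach hP (((hC _).reach hi hi').trans hij)
  have hCn : (C' n).Nonempty := by
    obtain ⟨i, hi⟩ : (constraintGraph δ).IsSCC (C' n) := hC _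
    exact ⟨i, hi ▸ WDigraph.mem_scc_self i⟩
  obtain ⟨i, hi⟩ := hCn
  obtain ⟨T, hT⟩ := exists_responds hP.1 i.2
  exact key n le_rfl T {n | n.2 ≤ T} (fun _ h => h) (by simp [hne]) ⟨i, hi, hT⟩

end Context

/-! ### The flooding protocol and the activation times that it spreads. -/

namespace Context

variable {γ : Context.{u, v, w, x}}

/-- A flooding protocol that spreads activation times of facts `f : F`, together with encodings of
these times into states and messages. The fact `f` is activated by the agent `src f`, on knowing
that the fact `pre f` has been activated or, if `pre f` is missing, on observing an external
input. -/
structure Flooding (γ : Context.{u, v, w, x}) (F : Type*) where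
  src : F → γ.Agent
  pre : F → Option F
  encState : ∀ i, (F → ℕ∞) → γ.State i
  decState : ∀ i, γ.State i → F → ℕ∞
  dec_encState : ∀ i K, decState i (encState i K) = K
  encMsg : (F → ℕ∞) → γ.Msg
  decMsg : γ.Msg → F → ℕ∞
  dec_encMsg : ∀ K, decMsg (encMsg K) = K
  resp : γ.Agent → (F → ℕ∞) → ℕ → Prop

namespace Flooding

variable {F : Type*} (A : Flooding γ F) (e : γ.Input)

/-- The new activation times known to `i`. -/
noncomputable def update (i : γ.Agent) (K : F → ℕ∞) (ins : Set {e : γ.Input // γ.observer e = i})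
    (ms : Set (γ.Msg × γ.Agent)) (t : ℕ) (f : F) : ℕ∞ :=
  -- The value `⊤` means that no activation is known. A prerequisite is read from the old knowledge
  -- `K`, so an activation that it causes comes strictly later.
  sInf {k | k = K f ∨ (∃ m ∈ ms, k = A.decMsg m.1 f) ∨
    (A.src f = i ∧ k = t ∧
      ((A.pre f = none ∧ ∃ x ∈ ins, x.1 = e) ∨ ∃ g, A.pre f = some g ∧ K g < ⊤))}

/-- The joint protocol of a flooding. -/
noncomputable def protocol : γ.Protocol := fun i =>
  { initial := {A.encState i ⊤}
    initial_nonempty := ⟨_, rfl⟩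
    act := fun σ ins ms t =>
      { newState := A.encState i (A.update e i (A.decState i σ) ins ms t)
        sends := {m | m.1 = A.encMsg (A.update e i (A.decState i σ) ins ms t)}
        responds := A.resp i (A.update e i (A.decState i σ) ins ms t) t } }

/-- What `i` knows just before time `t`. -/
def before (r : γ.History) (i : γ.Agent) (t : ℕ) : F → ℕ∞ := A.decState i (r.stateBefore i t)

/-- What `i` knows at time `t`. -/
def known (r : γ.History) (i : γ.Agent) (t : ℕ) : F → ℕ∞ := A.decState i (r.state t i)

variable {A e} {r : γ.History}

lemma known_eq_update (hr : IsRun (A.protocol e) r) (i : γ.Agent) (t : ℕ) :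
    A.known r i t =
      A.update e i (A.before r i t) (r.observedInputs i t) (r.observedMsgs i t) t := by
  rw [known, hr.state_eq]
  exact A.dec_encState _ _

lemma before_zero (hr : IsRun (A.protocol e) r) (i : γ.Agent) : A.before r i 0 = ⊤ := by
  have : r.initial i = A.encState i ⊤ := hr.initial_mem i
  rw [before, History.stateBefore, this, A.dec_encState]

lemma respondsAt_iff (hr : IsRun (A.protocol e) r) (i : γ.Agent) (t : ℕ) :
    r.RespondsAt (A.protocol e) i t ↔ A.resp i (A.known r i t) t := by
  rw [known_eq_update hr]
  rfl

lemma msg_eq_of_mem_deliveries (hr : IsRun (A.protocol e) r) {d : γ.Delivery} {t : ℕ}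
    (hd : d ∈ r.deliveries t) : A.decMsg d.msg = A.known r d.src d.sentAt := by
  have : d.msg = A.encMsg _ := hr.sent_of_delivered d t hd
  rw [known_eq_update hr, this, A.dec_encMsg]
  rfl

lemma sentAt_lt_of_mem_deliveries (hr : IsRun (A.protocol e) r) {d : γ.Delivery} {t : ℕ}
    (hd : d ∈ r.deliveries t) : d.sentAt < t := by
  obtain ⟨t', h, -, h'⟩ := hr.delivered d (hr.sent_of_delivered d t hd)
  rwa [(h' t).1 hd]

lemma sent_known (hr : IsRun (A.protocol e) r) {i j : γ.Agent} (h : γ.graph.Adj i j) (t : ℕ) :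
    r.Sent (A.protocol e) ⟨A.encMsg (A.known r i t), t, i, j, h⟩ := by
  rw [known_eq_update hr]
  rfl

lemma known_antitone (hr : IsRun (A.protocol e) r) (i : γ.Agent) : Antitone (A.known r i) := by
  refine antitone_nat_of_succ_le fun t f => ?_
  rw [known_eq_update hr i (t + 1)]
  exact sInf_le (.inl rfl)

lemma known_le_of_mem_deliveries (hr : IsRun (A.protocol e) r) {d : γ.Delivery} {t : ℕ}
    (hd : d ∈ r.deliveries t) : A.known r d.dst t ≤ A.known r d.src d.sentAt := by
  intro f
  rw [known_eq_update hr d.dst, ← msg_eq_of_mem_deliveries hr hd]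
  exact sInf_le (.inr (.inl ⟨(d.msg, d.src), ⟨d, hd, rfl, rfl, rfl⟩, rfl⟩))

lemma known_le_of_observed (hr : IsRun (A.protocol e) r) {f : F} (hf : A.pre f = none)
    (hs : A.src f = γ.observer e) {t : ℕ} (ht : e ∈ r.inputs t) : A.known r (A.src f) t f ≤ t := by
  rw [known_eq_update hr]
  exact sInf_le (.inr (.inr ⟨rfl, rfl, .inl ⟨hf, ⟨e, hs.symm⟩, ht, rfl⟩⟩))

lemma known_le_of_pre (hr : IsRun (A.protocol e) r) {f g : F} (hf : A.pre f = some g)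
    {t : ℕ} (hg : A.known r (A.src f) t g < ⊤) : A.known r (A.src f) (t + 1) f ≤ (t + 1 : ℕ) := by
  rw [known_eq_update hr]
  exact sInf_le (.inr (.inr ⟨rfl, rfl, .inr ⟨g, hf, hg⟩⟩))

lemma known_cases (hr : IsRun (A.protocol e) r) {i : γ.Agent} {t : ℕ} {f : F}
    (h : A.known r i t f < ⊤) :
    (∃ t', t = t' + 1 ∧ A.known r i t' f = A.known r i t f) ∨
    (∃ d ∈ r.deliveries t, A.known r d.src d.sentAt f = A.known r i t f) ∨
    (A.src f = i ∧ A.known r i t f = t ∧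
      ((A.pre f = none ∧ e ∈ r.inputs t) ∨
        ∃ g t', A.pre f = some g ∧ t = t' + 1 ∧ A.known r i t' g < ⊤)) := by
  have hmem : A.known r i t f ∈ {k | k = A.before r i t f ∨
      (∃ m ∈ r.observedMsgs i t, k = A.decMsg m.1 f) ∨ (A.src f = i ∧ k = t ∧
      ((A.pre f = none ∧ ∃ x ∈ r.observedInputs i t, x.1 = e) ∨
        ∃ g, A.pre f = some g ∧ A.before r i t g < ⊤))} := by
    rw [known_eq_update hr]
    exact csInf_mem ⟨_, .inl rfl⟩
  rcases hmem with hk | ⟨m, ⟨d, hd, -, hm, -⟩, hk⟩ | ⟨hf, hk, hk'⟩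
  · left
    cases t with
    | zero =>
      rw [before_zero hr] at hk
      rw [hk] at h
      exact absurd h (lt_irrefl _)
    | succ t => exact ⟨t, rfl, hk.symm⟩
  · right; left
    rw [← hm, msg_eq_of_mem_deliveries hr hd] at hk
    exact ⟨d, hd, hk.symm⟩
  · right; right
    refine ⟨hf, hk, ?_⟩
    rcases hk' with ⟨h1, x, hx, rfl⟩ | ⟨g, hg, hlt⟩
    · exact .inl ⟨h1, hx⟩
    · right
      cases t with
      | zero =>
        rw [before_zero hr] at hlt
        exact absurd hlt (lt_irrefl _)
      | succ t => exact ⟨g, t, hg, rfl, hlt⟩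

/-- Values are created only by the source, which stamps the current time; tracing a value back
through memory and messages ends there. -/
lemma known_spec (hr : IsRun (A.protocol e) r) {i : γ.Agent} {t k : ℕ} {f : F}
    (h : A.known r i t f = k) : k ≤ t ∧ A.known r (A.src f) k f = k := by
  induction t using Nat.strong_induction_on generalizing i with
  | _ t ih =>
    rcases known_cases hr (h ▸ ENat.natCast_lt_top k : A.known r i t f < ⊤) with
      ⟨t', rfl, h'⟩ | ⟨d, hd, h'⟩ | ⟨rfl, h', -⟩
    · have := ih t' (Nat.lt_succ_self t') (h'.trans h)
      exact ⟨by omega, this.2⟩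
    · have hlt := sentAt_lt_of_mem_deliveries hr hd
      have := ih _ hlt (h'.trans h)
      exact ⟨by omega, this.2⟩
    · obtain rfl : k = t := by exact_mod_cast h.symm.trans h'
      exact ⟨le_rfl, h⟩

/-- The time at which a fact is activated in a run. -/
noncomputable def activation (A : Flooding γ F) (r : γ.History) (f : F) : ℕ∞ :=
  ⨅ t, A.known r (A.src f) t f

lemma activation_le_known (hr : IsRun (A.protocol e) r) (i : γ.Agent) (t : ℕ) (f : F) :
    A.activation r f ≤ A.known r i t f := by
  cases h : A.known r i t f with
  | top => exact le_top
  | coe k => exact (iInf_le _ k).trans (known_spec hr h).2.le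

lemma known_of_activation (hr : IsRun (A.protocol e) r) {f : F} {s : ℕ}
    (h : A.activation r f = s) : A.known r (A.src f) s f = s := by
  obtain ⟨t, ht⟩ : A.activation r f ∈ Set.range fun t => A.known r (A.src f) t f :=
    csInf_mem (Set.range_nonempty _)
  exact (known_spec hr (ht.trans h)).2

lemma exists_known_le (hr : IsRun (A.protocol e) r) {i j : γ.Agent} (h : γ.graph.Reach i j)
    (t : ℕ) : ∃ t', A.known r j t' ≤ A.known r i t := by
  rw [WDigraph.reach_iff] at h
  induction h with
  | refl => exact ⟨t, le_rfl⟩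
  | tail _ hbc ih =>
    obtain ⟨t', h'⟩ := ih
    obtain ⟨t'', -, -, hd⟩ := hr.delivered _ (sent_known hr hbc t')
    exact ⟨t'', (known_le_of_mem_deliveries hr ((hd t'').2 rfl)).trans h'⟩

lemma exists_delay (F : Type*) (e : γ.Input) {i j : γ.Agent} (h : γ.graph.dist i j < ⊤) :
    ∃ d : ℕ, ∀ (A : Flooding γ F) (r : γ.History), IsRun (A.protocol e) r →
      ∀ t, A.known r j (t + d) ≤ A.known r i t := by
  rw [WDigraph.dist_lt_top_iff] at h
  induction h with
  | refl => exact ⟨0, fun _ _ _ _ => le_rfl⟩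
  | @tail b c _ hbc ih =>
    obtain ⟨d, hd⟩ := ih
    obtain ⟨b', hb'⟩ := ENat.ne_top_iff_exists.1 hbc.2.ne
    refine ⟨d + b', fun A r hr t => ?_⟩
    obtain ⟨t', -, hle, hdel⟩ := hr.delivered _ (sent_known hr hbc.1 (t + d))
    dsimp only at hle
    rw [← hb'] at hle
    have hle' : t' ≤ t + d + b' := by exact_mod_cast hle
    exact (known_antitone hr c (by omega)).trans
      ((known_le_of_mem_deliveries hr ((hdel t').2 rfl)).trans (hd A r hr t))

lemma activation_pre_le (hr : IsRun (A.protocol e) r) {f g : F} (hf : A.pre f = some g) :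
    A.activation r g ≤ A.activation r f := by
  refine le_iInf fun t => ?_
  by_cases hlt : A.known r (A.src f) t f < ⊤
  · obtain ⟨k, hk⟩ := ENat.ne_top_iff_exists.1 hlt.ne
    rw [← hk]
    replace hk := (known_spec hr hk.symm).2
    -- At time `k` the value `k` can be neither remembered nor received, since by `known_spec` no
    -- one holds it before `k`. So it was created then, and the prerequisite was already known.
    rcases known_cases hr (hk ▸ ENat.natCast_lt_top k : A.known r (A.src f) k f < ⊤) with
      ⟨t', ht, h⟩ | ⟨d, hd, h⟩ | ⟨-, -, h⟩
    · have := (known_spec hr (h.trans hk)).1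
      omega
    · have := (known_spec hr (h.trans hk)).1
      have := sentAt_lt_of_mem_deliveries hr hd
      omega
    · rcases h with ⟨h, -⟩ | ⟨g', t', hg', rfl, hlt⟩
      · rw [hf] at h; cases h
      obtain rfl : g = g' := Option.some.inj (hf.symm.trans hg')
      refine (activation_le_known hr (A.src f) t' g).trans ?_
      obtain ⟨k, hk⟩ := ENat.ne_top_iff_exists.1 hlt.ne
      rw [← hk]
      have := (known_spec hr hk.symm).1
      exact_mod_cast (by omega : k ≤ t' + 1)
  · rw [not_lt, top_le_iff] at hlt
    rw [hlt]
    exact le_top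

lemma activation_lt_top_of_triggered (hr : IsRun (A.protocol e) r) (ht : r.Triggered e) {f : F}
    (hf : A.pre f = none) (hs : A.src f = γ.observer e) : A.activation r f < ⊤ := by
  obtain ⟨t, ht⟩ := ht
  exact ((iInf_le _ t).trans (known_le_of_observed hr hf hs ht)).trans_lt (ENat.natCast_lt_top t)

lemma activation_lt_top_of_pre (hr : IsRun (A.protocol e) r) {f g : F}
    (hf : A.pre f = some g) (hs : γ.graph.Reach (A.src g) (A.src f))
    (h : A.activation r g < ⊤) : A.activation r f < ⊤ := by
  obtain ⟨t, ht⟩ := iInf_lt_iff.1 h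
  obtain ⟨t', h'⟩ := exists_known_le hr hs t
  exact ((iInf_le _ (t' + 1)).trans (known_le_of_pre hr hf ((h' g).trans_lt ht))).trans_lt
    (ENat.natCast_lt_top _)

lemma triggered_of_known_lt_top (hr : IsRun (A.protocol e) r) {i : γ.Agent} {t : ℕ} {f : F}
    (h : A.known r i t f < ⊤) : r.Triggered e := by
  induction t using Nat.strong_induction_on generalizing i f with
  | _ t ih =>
    rcases known_cases hr h with ⟨t', rfl, h'⟩ | ⟨d, hd, h'⟩ | ⟨-, -, ⟨-, h'⟩ | ⟨g, t', -, rfl, h'⟩⟩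
    · exact ih t' (Nat.lt_succ_self t') (h'.trans_lt h)
    · exact ih _ (sentAt_lt_of_mem_deliveries hr hd) (h'.trans_lt h)
    · exact ⟨t, h'⟩
    · exact ih t' (Nat.lt_succ_self t') h'

lemma activation_eq_top (hr : IsRun (A.protocol e) r) (ht : ¬ r.Triggered e) (f : F) :
    A.activation r f = ⊤ :=
  iInf_eq_top.2 fun _ => by_contra fun h => ht (triggered_of_known_lt_top hr (lt_top_iff_ne_top.2 h))

/-- At time `t`, an agent that hears of the activation of `f` with delay at most `B` knows whether
`f` was activated at least `B` before any time up to `t`. -/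
lemma known_add_le_iff (hr : IsRun (A.protocol e) r) {f : F} {j : γ.Agent} {B : ℕ}
    (hB : ∃ d ≤ B, ∀ t, A.known r j (t + d) ≤ A.known r (A.src f) t) {t τ : ℕ} (h : τ ≤ t) :
    A.known r j t f + B ≤ τ ↔ A.activation r f + B ≤ τ := by
  refine ⟨fun h' => (add_le_add_left (activation_le_known hr j t f) _).trans h', fun h' => ?_⟩
  obtain ⟨d, hdB, hd⟩ := hB
  cases hs : A.activation r f with
  | top => rw [hs] at h'; simp at h'
  | coe s =>
    rw [hs] at h'
    have h'' : s + B ≤ τ := by exact_mod_cast h'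
    refine le_trans (add_le_add_left ?_ _) h'
    refine le_trans ?_ (known_of_activation hr hs).le
    exact (known_antitone hr j (by omega : s + d ≤ t) f).trans (hd s f)

end Flooding

/-- Flooding can be carried out in every context with enough states and messages. -/
lemma exists_flooding [Infinite γ.Msg] [∀ i, Infinite (γ.State i)] {F : Type*} [Finite F]
    (src : F → γ.Agent) (pre : F → Option F) (resp : γ.Agent → (F → ℕ∞) → ℕ → Prop) :
    ∃ A : Flooding γ F, A.src = src ∧ A.pre = pre ∧ A.resp = resp := by
  have : Countable ℕ∞ := inferInstanceAs (Countable (Option ℕ))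
  obtain ⟨c, hc⟩ := exists_injective_nat (F → ℕ∞)
  have hS := fun i => ((Infinite.natEmbedding (γ.State i)).injective.comp hc).hasLeftInverse
  choose decS hdecS using hS
  obtain ⟨decM, hdecM⟩ := ((Infinite.natEmbedding γ.Msg).injective.comp hc).hasLeftInverse
  exact ⟨⟨src, pre, _, decS, hdecS, _, decM, hdecM, resp⟩, rfl, rfl, rfl⟩

end Context

/-! ### Ranks of components, chains, and the waiting rule. -/

namespace WDigraph

variable {V : Type*} {W : Type*} {G : WDigraph V W}

/-- In a finite graph, the strongly connected components can be ranked along the paths. -/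
lemma exists_rank [Finite V] (G : WDigraph V W) : ∃ pos : V → Fin (Nat.card V + 1),
    ∀ i j, G.Reach i j → pos i ≤ pos j ∧ (pos i = pos j → G.Reach j i) := by
  have hsub : ∀ i j, G.Reach i j → {k | ¬ G.Reach i k} ⊆ {k | ¬ G.Reach j k} :=
    fun i j h k hk hjk => hk (h.trans hjk)
  -- The rank counts unreachable vertices; it grows along a path, strictly on leaving a component.
  refine ⟨fun i => ⟨Set.ncard {k | ¬ G.Reach i k}, Nat.lt_succ_of_le (Set.ncard_le_card _)⟩,
    fun i j h => ⟨Set.ncard_le_ncard (hsub i j h) (Set.toFinite _), fun he => ?_⟩⟩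
  have := Set.eq_of_subset_of_ncard_le (hsub i j h) (Fin.mk.inj he).ge (Set.toFinite _)
  by_contra hji
  have hmem : i ∈ {k | ¬ G.Reach j k} := hji
  rw [← this] at hmem
  exact hmem (.refl i)

/-- A sequence of `N + 1` vertices with a path from each to the later ones. -/
def Chain (G : WDigraph V W) (N : ℕ) : Type _ :=
  {c : Fin (N + 1) → V // ∀ k l, k ≤ l → G.Reach (c k) (c l)}

instance [Finite V] (N : ℕ) : Finite (G.Chain N) :=
  inferInstanceAs (Finite {c : Fin (N + 1) → V // ∀ k l, k ≤ l → G.Reach (c k) (c l)})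

/-- Given times `K c m` for every chain `c` and position `m`, some initial segment of a chain that
ends at position `m` in the component of `j` is such that for all its continuations the times at
position `m` are at most `τ`. -/
def Ready {N : ℕ} (K : G.Chain N → Fin (N + 1) → ℕ∞) (m : Fin (N + 1)) (j : V) (τ : ℕ∞) : Prop :=
  ∃ p : G.Chain N, j ∈ G.scc (p.1 m) ∧ ∀ c : G.Chain N, (∀ k ≤ m, c.1 k = p.1 k) → K c m ≤ τ

variable {N : ℕ} {K K' : G.Chain N → Fin (N + 1) → ℕ∞} {m m' : Fin (N + 1)} {i j : V} {τ : ℕ∞}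

/-- This dictates the quantifiers in `Ready`. A segment witnessing readiness of `i` extends by
copies of `j`; every continuation of the extension also continues the original, and times only
decrease along a chain. Hence `j` is ready no later than `i`. -/
lemma Ready.of_reach (hK : ∀ c, Antitone (K c)) (hij : G.Reach i j) (hm : m ≤ m')
    (hji : m = m' → G.Reach j i) (h : Ready K m i τ) : Ready K m' j τ := by
  obtain ⟨p, hp, hc⟩ := h
  rcases hm.eq_or_lt with rfl | hlt
  · exact ⟨p, ⟨hp.1.trans hij, (hji rfl).trans hp.2⟩, hc⟩
  refine ⟨⟨fun k => if k ≤ m then p.1 k else j, fun k l hkl => ?_⟩, ?_, fun c hcp => ?_⟩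
  · by_cases hl : l ≤ m
    · simpa [hl, hkl.trans hl] using p.2 k l hkl
    · by_cases hk : k ≤ m
      · simpa [hl, hk] using ((p.2 k m hk).trans hp.1).trans hij
      · simpa [hl, hk] using Reach.refl j
  · simpa [hlt.not_ge] using mem_scc_self j
  · refine (hK c hm).trans (hc c fun k hk => ?_)
    simpa [hk] using hcp k (hk.trans hm)

lemma Ready.congr (h : ∀ c : G.Chain N, j ∈ G.scc (c.1 m) → (K c m ≤ τ ↔ K' c m ≤ τ)) :
    Ready K m j τ ↔ Ready K' m j τ := by
  refine exists_congr fun p => and_congr_right fun hp => forall_congr' fun c =>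
    forall_congr' fun hc => h c ?_
  rwa [hc m le_rfl]

lemma exists_ready [Finite V] (hK : ∀ c, K c m < ⊤) (j : V) : ∃ τ : ℕ, Ready K m j τ := by
  choose f hf using fun c => ENat.ne_top_iff_exists.1 (hK c).ne
  obtain ⟨τ, hτ⟩ := Finite.bddAbove_range f
  refine ⟨τ, ⟨fun _ => j, fun _ _ _ => .refl j⟩, mem_scc_self j, fun c _ => ?_⟩
  rw [← hf]
  exact_mod_cast hτ ⟨c, rfl⟩

lemma not_ready (hK : ∀ c, K c m = ⊤) (hτ : τ < ⊤) : ¬ Ready K m j τ := by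
  rintro ⟨p, -, h⟩
  have := h p fun _ _ => rfl
  rw [hK] at this
  exact (this.trans_lt hτ).false

end WDigraph

lemma IsLeast.congr_le {S S' : Set ℕ} {τ t : ℕ} (h : ∀ n ≤ t, n ∈ S ↔ n ∈ S') (hτ : τ ≤ t) :
    IsLeast S τ ↔ IsLeast S' τ := by
  have aux : ∀ {S S' : Set ℕ}, (∀ n ≤ t, n ∈ S ↔ n ∈ S') → IsLeast S τ → IsLeast S' τ := by
    intro S S' h hS
    refine ⟨(h τ hτ).1 hS.1, fun n hn => ?_⟩
    by_contra hlt
    exact hlt (hS.2 ((h n (by omega)).2 hn))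
  exact ⟨aux h, aux fun n hn => (h n hn).symm⟩

/-! ### Sufficiency, and the special cases of the criterion. -/

namespace Context

variable {γ : Context.{u, v, w, x}} {e : γ.Input} {I : Set γ.Agent} {δ : I → I → WithTop ℤ}

theorem solvable_TCR_of_chainCondition [Infinite γ.Msg] [∀ i, Infinite (γ.State i)]
    (hI : I.Finite) (hδ : (constraintGraph δ).NoNegCycle) (h : γ.ChainCondition e I δ) :
    Solvable (γ.TCR e I δ) := by
  classical
  have : Finite I := hI
  let G := constraintGraph δ
  obtain ⟨φ, hφ⟩ := hδ.exists_potential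
  obtain ⟨pos, hpos⟩ := G.exists_rank
  let N := Nat.card I
  choose a ha1 ha2 ha3 using fun c : G.Chain N => h N (fun m => G.scc (c.1 m))
    (fun m => WDigraph.isSCC_scc _) (fun m => ⟨_, WDigraph.mem_scc_self _, _,
      WDigraph.mem_scc_self _, c.2 _ _ (Fin.castSucc_lt_succ).le⟩)
  -- The fact `none` is the occurrence of `e`; `(c, m)` is activated by the relay `a c m` once `(c,
  -- m + 1)` is known, or `none` if `m = N`. Relays depend on the whole chain, so each chain has
  -- facts of its own.
  let F := Option (G.Chain N × Fin (N + 1))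
  let src : F → γ.Agent := fun f => f.elim (γ.observer e) fun cm => a cm.1 cm.2
  let pre : F → Option F := fun f => f.elim none fun cm =>
    some (if h : (cm.2 : ℕ) + 1 < N + 1 then some (cm.1, ⟨cm.2 + 1, h⟩) else none)
  have hpre_last : ∀ c, pre (some (c, Fin.last N)) = some none := by
    intro c
    simp [pre]
  have hpre_succ : ∀ c (m : Fin N), pre (some (c, m.castSucc)) = some (some (c, m.succ)) := by
    intro c m
    have := m.2
    simp only [pre, Option.elim, Fin.val_castSucc]
    rw [dif_pos (by omega)]
    rfl
  obtain ⟨B, hB⟩ : ∃ B, ∀ c m j, j ∈ G.scc (c.1 m) → ∃ d ≤ B, ∀ (A : Flooding γ F)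
      (r : γ.History), IsRun (A.protocol e) r → ∀ t, A.known r j (t + d) ≤ A.known r (a c m) t := by
    have hd : ∀ cmj : G.Chain N × Fin (N + 1) × I, ∃ d, cmj.2.2 ∈ G.scc (cmj.1.1 cmj.2.1) →
        ∀ (A : Flooding γ F) (r : γ.History), IsRun (A.protocol e) r →
          ∀ t, A.known r cmj.2.2 (t + d) ≤ A.known r (a cmj.1 cmj.2.1) t := by
      rintro ⟨c, m, j⟩
      by_cases hj : j ∈ G.scc (c.1 m)
      · obtain ⟨d, hd⟩ := Flooding.exists_delay F e (ha3 c m j hj)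
        exact ⟨d, fun _ => hd⟩
      · exact ⟨0, fun h => absurd h hj⟩
    choose d hd using hd
    obtain ⟨B, hB⟩ := Finite.bddAbove_range d
    exact ⟨B, fun c m j hj => ⟨d (c, m, j), hB ⟨_, rfl⟩, hd (c, m, j) hj⟩⟩
  -- By this time the activation is known throughout the component of `c m`.
  let time : (F → ℕ∞) → G.Chain N → Fin (N + 1) → ℕ∞ := fun K c m => K (some (c, m)) + B
  let ready : (F → ℕ∞) → I → Set ℕ := fun K j => {τ | WDigraph.Ready (time K) (pos j) j τ}
  obtain ⟨A, hsrc, hpre, hresp⟩ := exists_flooding src pre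
    (fun i K t => ∃ h : i ∈ I, ∃ τ, τ + φ ⟨i, h⟩ = t ∧ IsLeast (ready K ⟨i, h⟩) τ)
  have hrespond : ∀ r, IsRun (A.protocol e) r → ∀ (j : I) t, r.RespondsAt (A.protocol e) j t ↔
      ∃ τ, τ + φ j = t ∧ IsLeast (ready (A.activation r) j) τ := by
    intro r hr j t
    rw [Flooding.respondsAt_iff hr, hresp]
    -- Local knowledge at `t` decides readiness at all times up to `t`, so `j` recognises the least
    -- ready time in terms of the true activations.
    have hj : ∀ τ, τ + φ j = t → (IsLeast (ready (A.known r j t) j) τ ↔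
        IsLeast (ready (A.activation r) j) τ) := by
      intro τ hτ
      refine IsLeast.congr_le (t := t) (fun n hn => ?_) (by omega)
      refine WDigraph.Ready.congr fun c hc => ?_
      refine Flooding.known_add_le_iff hr ?_ hn
      obtain ⟨d, hd, h⟩ := hB c _ j hc
      exact ⟨d, hd, fun t => by rw [hsrc]; exact h A r hr t⟩
    constructor
    · rintro ⟨_, τ, h1, h2⟩
      exact ⟨τ, h1, (hj τ h1).1 h2⟩
    · rintro ⟨τ, h1, h2⟩
      exact ⟨j.2, τ, h1, (hj τ h1).2 h2⟩
  have hanti : ∀ r, IsRun (A.protocol e) r → ∀ c, Antitone (time (A.activation r) c) := by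
    intro r hr c
    rw [Fin.antitone_iff_succ_le]
    intro m
    exact add_le_add_left (Flooding.activation_pre_le hr (by rw [hpre, hpre_succ])) _
  have hfin : ∀ r, IsRun (A.protocol e) r → r.Triggered e →
      ∀ c m, time (A.activation r) c m < ⊤ := by
    intro r hr ht c m
    refine ENat.add_lt_top.2 ⟨?_, ENat.natCast_lt_top _⟩
    induction m using Fin.reverseInduction with
    | last =>
      refine Flooding.activation_lt_top_of_pre hr (by rw [hpre, hpre_last]) ?_
        (Flooding.activation_lt_top_of_triggered hr ht (by rw [hpre]; rfl) (by rw [hsrc]; rfl))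
      rw [hsrc]
      exact ha1 c
    | cast m ih =>
      refine Flooding.activation_lt_top_of_pre hr (by rw [hpre, hpre_succ]) ?_ ih
      rw [hsrc]
      exact ha2 c m
  have hleast : ∀ r, IsRun (A.protocol e) r → r.Triggered e → ∀ j,
      ∃ τ, IsLeast (ready (A.activation r) j) τ := by
    intro r hr ht j
    exact ⟨_, isLeast_csInf (WDigraph.exists_ready (fun c => hfin r hr ht c _) j)⟩
  have hER : A.protocol e ∈ γ.ER e I := by
    intro r hr
    constructor
    · intro ht i hi
      obtain ⟨τ, hτ⟩ := hleast r hr ht ⟨i, hi⟩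
      refine ⟨_, (hrespond r hr ⟨i, hi⟩ _).2 ⟨τ, rfl, hτ⟩, fun t h => ?_⟩
      obtain ⟨τ', rfl, hτ'⟩ := (hrespond r hr ⟨i, hi⟩ t).1 h
      rw [hτ.unique hτ']
    · intro ht i hi t h
      obtain ⟨τ, -, hτ⟩ := (hrespond r hr ⟨i, hi⟩ t).1 h
      refine WDigraph.not_ready (fun c => ?_) (ENat.natCast_lt_top _) hτ.1
      simp [time, Flooding.activation_eq_top hr ht]
  refine ⟨A.protocol e, hER, fun r hr ht => ?_⟩
  choose τ hτ using hleast r hr ht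
  refine ⟨fun j => τ j + φ j, fun j => ?_, fun i j hij => ?_⟩
  · exact responseTime_eq ((hER r hr).1 ht j j.2) ((hrespond r hr j _).2 ⟨τ j, rfl, hτ j⟩)
  · by_cases hd : δ i j = ⊤
    · rw [hd]; simp
    have hreach : G.Reach i j := .of_adj ⟨hij, hd⟩
    have hle : τ j ≤ τ i := (hτ j).2 <| WDigraph.Ready.of_reach (hanti r hr) hreach
      (hpos i j hreach).1 (hpos i j hreach).2 (hτ i).1
    have hφ' : (((φ j : ℕ) : ℤ) : WithTop ℤ) ≤ (((φ i : ℕ) : ℤ) : WithTop ℤ) + δ i j :=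
      hφ i j ⟨hij, hd⟩
    obtain ⟨w, hw⟩ := WithTop.ne_top_iff_exists.1 hd
    rw [← hw] at hφ' ⊢
    norm_cast at hφ' ⊢
    push_cast
    omega

theorem solvable_TCR_iff [Infinite γ.Msg] [∀ i, Infinite (γ.State i)]
    (hI : I.Finite) (hδ : (constraintGraph δ).NoNegCycle) :
    Solvable (γ.TCR e I δ) ↔ γ.ChainCondition e I δ :=
  ⟨fun ⟨_, hP⟩ => chainCondition_of_mem_TCR hI hP, solvable_TCR_of_chainCondition hI hδ⟩

lemma stronglyConnected_zero (I : Set γ.Agent) :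
    (constraintGraph (0 : I → I → WithTop ℤ)).StronglyConnected := by
  intro i j
  by_cases h : i = j
  · exact h ▸ .refl i
  · exact .of_adj ⟨h, WithTop.coe_ne_top⟩

lemma noNegCycle_zero (I : Set γ.Agent) :
    (constraintGraph (0 : I → I → WithTop ℤ)).NoNegCycle := by
  intro i p _
  have : ∀ l l' : List I, (List.zipWith (0 : I → I → WithTop ℤ) l l').sum = 0 := by
    intro l
    induction l with
    | nil => simp
    | cons a l ih => intro l'; cases l' <;> simp [ih]
  exact (this _ _).not_lt

/-- Zero bounds in both directions force equality; in untriggered runs all response times are `⊤`.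
-/
lemma SR_eq_TCR : γ.SR e I = γ.TCR e I 0 := by
  ext P
  refine and_congr_right fun hER => ⟨fun h r hr ht => ?_, fun h r hr => ?_⟩
  · obtain ⟨T, hT⟩ := h r hr
    choose t ht' using fun i : I => ((hER r hr).1 ht i i.2).exists
    have ht'' := fun i : I => responseTime_eq ((hER r hr).1 ht i i.2) (ht' i)
    refine ⟨t, ht'', fun i j _ => ?_⟩
    have : t j = t i := by
      exact_mod_cast (ht'' j).symm.trans ((hT j j.2).trans ((hT i i.2).symm.trans (ht'' i)))
    simp [this]
  · by_cases ht : r.Triggered e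
    · obtain ⟨t, h1, h2⟩ := h r hr ht
      rcases I.eq_empty_or_nonempty with rfl | ⟨i, hi⟩
      · exact ⟨0, by simp⟩
      have hle : ∀ i j : I, t j ≤ t i := by
        intro i j
        by_cases hij : i = j
        · rw [hij]
        · have := h2 i j hij
          simpa using this
      refine ⟨t ⟨i, hi⟩, fun j hj => (h1 ⟨j, hj⟩).trans ?_⟩
      rw [le_antisymm (hle ⟨i, hi⟩ ⟨j, hj⟩) (hle ⟨j, hj⟩ ⟨i, hi⟩)]
    · refine ⟨⊤, fun i hi => ?_⟩
      refine sInf_eq_top.2 ?_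
      rintro _ ⟨t, h', rfl⟩
      exact absurd h' ((hER r hr).2 ht i hi t)

/-- The only component is all of `I`, so one agent serves at every position. For empty `I` there are
no components and the condition is vacuous. -/
lemma chainCondition_iff_of_stronglyConnected (hδ : (constraintGraph δ).StronglyConnected) :
    γ.ChainCondition e I δ ↔ (I.Nonempty →
      ∃ a, γ.graph.Reach (γ.observer e) a ∧ ∀ j ∈ I, γ.graph.dist a j < ⊤) := by
  constructor
  · rintro h ⟨i, hi⟩
    obtain ⟨a, h1, -, h3⟩ := h 0 (fun _ => (constraintGraph δ).scc ⟨i, hi⟩)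
      (fun _ => WDigraph.isSCC_scc _) (fun m => m.elim0)
    exact ⟨a 0, h1, fun j hj => h3 0 ⟨j, hj⟩ ⟨hδ _ _, hδ _ _⟩⟩
  · rintro h n C hC _
    obtain ⟨i, -⟩ := hC 0
    obtain ⟨a, h1, h2⟩ := h ⟨i, i.2⟩
    exact ⟨fun _ => a, h1, fun _ => .refl a, fun _ j _ => h2 j j.2⟩

lemma solvable_SR_iff [Infinite γ.Msg] [∀ i, Infinite (γ.State i)] (hI : I.Finite) :
    Solvable (γ.SR e I) ↔ (I.Nonempty →
      ∃ a, γ.graph.Reach (γ.observer e) a ∧ ∀ j ∈ I, γ.graph.dist a j < ⊤) := by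
  rw [SR_eq_TCR, solvable_TCR_iff hI (noNegCycle_zero I),
    chainCondition_iff_of_stronglyConnected (stronglyConnected_zero I)]

lemma solvable_TCR_iff_solvable_SR [Infinite γ.Msg] [∀ i, Infinite (γ.State i)] (hI : I.Finite)
    (hδ : (constraintGraph δ).StronglyConnected) (hδ' : (constraintGraph δ).NoNegCycle) :
    Solvable (γ.TCR e I δ) ↔ Solvable (γ.SR e I) := by
  rw [solvable_TCR_iff hI hδ', chainCondition_iff_of_stronglyConnected hδ, solvable_SR_iff hI]

lemma chainCondition_iff_hasBoundedSource (hγ : γ.graph.StronglyConnected) :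
    γ.ChainCondition e I δ ↔
      ∀ J : Set I, (constraintGraph δ).IsSCC J → γ.HasBoundedSource (Subtype.val '' J) := by
  constructor
  · intro h J hJ
    obtain ⟨a, -, -, h3⟩ := h 0 (fun _ => J) (fun _ => hJ) (fun m => m.elim0)
    refine ⟨a 0, ?_⟩
    rintro _ ⟨j, hj, rfl⟩
    exact h3 0 j hj
  · intro h n C hC _
    choose a ha using fun m => h (C m) (hC m)
    exact ⟨a, hγ _ _, fun _ => hγ _ _, fun m j hj => ha m j ⟨j, hj, rfl⟩⟩

end Context

theorem mainTheorem10 (γ : Context.{u, v, w, x})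
    [Infinite γ.Msg] [∀ i, Infinite (γ.State i)]
    (e : γ.Input) (I : Set γ.Agent) (hI : I.Finite) :
    -- the characterisation for strongly connected networks
    (∀ δ : I → I → WithTop ℤ, γ.graph.StronglyConnected → (constraintGraph δ).NoNegCycle →
      List.TFAE [
        Context.Solvable (γ.TCR e I δ),
        ∀ J : Set I, (constraintGraph δ).IsSCC J →
          Context.Solvable (γ.SR e (Subtype.val '' J)),
        ∀ J : Set I, (constraintGraph δ).IsSCC J → γ.HasBoundedSource (Subtype.val '' J)]) ∧
    -- the case of a strongly connected constraint graph, over an arbitrary network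
    (∀ δ : I → I → WithTop ℤ, (constraintGraph δ).StronglyConnected →
      (constraintGraph δ).NoNegCycle →
      (Context.Solvable (γ.TCR e I δ) ↔ Context.Solvable (γ.SR e I))) ∧
    List.TFAE [
      ∃ δ : I → I → WithTop ℤ, (constraintGraph δ).StronglyConnected ∧
        (constraintGraph δ).NoNegCycle ∧ Context.Solvable (γ.TCR e I δ),
      ∀ δ : I → I → WithTop ℤ, (constraintGraph δ).StronglyConnected →
        (constraintGraph δ).NoNegCycle → Context.Solvable (γ.TCR e I δ),
      Context.Solvable (γ.SR e I)] ∧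
    -- the general characterisation, over an arbitrary network
    (∀ δ : I → I → WithTop ℤ, (constraintGraph δ).NoNegCycle →
      (Context.Solvable (γ.TCR e I δ) ↔ γ.ChainCondition e I δ)) := by
  refine ⟨fun δ hγ hδ => ?_, fun δ hδ hδ' => Context.solvable_TCR_iff_solvable_SR hI hδ hδ', ?_,
    fun δ hδ => Context.solvable_TCR_iff hI hδ⟩
  · have : Finite I := hI
    tfae_have 1 ↔ 3 := by
      rw [Context.solvable_TCR_iff hI hδ, Context.chainCondition_iff_hasBoundedSource hγ]
    tfae_have 2 ↔ 3 := by
      refine forall_congr' fun J => forall_congr' fun hJ => ?_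
      rw [Context.solvable_SR_iff (J.toFinite.image _)]
      obtain ⟨i, hi⟩ := hJ
      have hne : (Subtype.val '' J).Nonempty := ⟨i, i, hi ▸ WDigraph.mem_scc_self i, rfl⟩
      exact ⟨fun h => (h hne).imp fun _ h => h.2, fun h _ => h.imp fun _ h => ⟨hγ _ _, h⟩⟩
    tfae_finish
  · tfae_have 1 → 3 := fun ⟨δ, h1, h2, h3⟩ =>
      (Context.solvable_TCR_iff_solvable_SR hI h1 h2).1 h3
    tfae_have 3 → 2 := fun h δ h1 h2 => (Context.solvable_TCR_iff_solvable_SR hI h1 h2).2 h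
    tfae_have 2 → 1 := fun h => ⟨0, Context.stronglyConnected_zero I, Context.noNegCycle_zero I,
      h 0 (Context.stronglyConnected_zero I) (Context.noNegCycle_zero I)⟩
    tfae_finish
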